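/- Let $X$ be a finite set and let $S:X\times X\to X\times X$, $S(x,y)=(g_x(y),f_y(x))$, be a non-degenerate symmetric set-theoretical solution: all maps $g_x,f_x:X\to X$ are bijective, $S\circ S=\mathrm{Id}$, and $S^{12}S^{23}S^{12}=S^{23}S^{12}S^{23}$ on $X^3$. A pair $(x,y)$ with $S(x,y)=(x,y)$ is called frozen, and $xy$ is then called a frozen element. Let $M(X,S)$ and $G(X,S)$ be the monoid and the group presented by $\langle X\mid xy=g_x(y)f_y(x)\text{ for } x,y\in X,\ S(x,y)\neq(x,y)\rangle$. An element of a monoid is balanced if its left divisors and its right divisors are the same; a Garside element is a balanced element whose divisors generate the monoid. Let $V$ be the real vector space with basis $X$, put $\phi_x=f_x^{-1}$, and let $\psi:G(X,S)\to GL(V)$ be the representation with $\psi_x(x)=-\phi_x(x)$ and $\psi_x(y)=\phi_x(y)$ for $y\in X$, $y\neq x$. Let $W=W(X,S)=\psi(G(X,S))$ and $\mathbf X=\{\psi_x\mid x\in X\}\subseteq W$; write $\psi$ also for the induced morphism $M(X,S)\to W$. For a group $W$ generated as a monoid by a subset $\mathbf X$, let $\ell$ be the word length on $\mathbf X$. If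 $w=vv'$ with $\ell(w)=\ell(v)+\ell(v')$, then $v$ is a left factor and $v'$ a right factor of $w$; $w$ is $\mathbf X$-balanced if its left factors and its right factors are the same, and $\mathrm{Div}_{\mathbf X}(w)$ is then the set of its factors. For such a $w$, $M_{w,\mathbf X}$ is the monoid with generators $\underline v$, $v\in\mathrm{Div}_{\mathbf X}(w)$, and relations $\underline 1=1$ and $\underline v\,\underline{v'}=\underline{v''}$ whenever $v,v',v''\in \mathrm{Div}_{\mathbf X}(w)$, $vv'=v''$ and $\ell(v)+\ell(v')=\ell(v'')$. We say that $(W,\mathbf X)$ is a generating generated section for a monoid $M$ through $w$ if $W$ is finite, $w$ is $\mathbf X$-balanced, $\mathrm{Div}_{\mathbf X}(w)=W$, and $M\cong M_{w,\mathbf X}$. Then $M(X,S)$ has a unique Garside element $\Delta$ that left-divides and right-divides every Garside element; let $\mathrm{Div}(\Delta)$ be its set of divisors. The following are equivalent: 1. $(W(X,S),\mathbf X)$ is a generating generated section for $M(X,S)$ through $\psi(\Delta)$; 2. $\psi(\mathrm{Div}(\Delta))=W(X,S)$; 3. Property $(\mathcal C)$: for every frozen pair $(x,y)$, $g_x\circ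 g_y=\mathrm{Id}_X$ and $f_y\circ f_x=\mathrm{Id}_X$. Moreover, in this case every frozen element $xy$ lies in $\mathrm{Ker}\,\psi$. -/

import Mathlib

noncomputable section

namespace YangBaxter

/-! ## Set-theoretical solutions -/

section Solutions

variable {X : Type*}

/-- The maps `g_x`, defined by `S (x, y) = (g_x y, f_y x)`. -/
def g (S : X × X → X × X) (x y : X) : X := (S (x, y)).1

/-- The maps `f_y`, defined by `S (x, y) = (g_x y, f_y x)`. -/
def f (S : X × X → X × X) (y x : X) : X := (S (x, y)).2

/-- `S` acting on the first and second components of `X ^ 3`. -/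
def act12 (S : X × X → X × X) (t : X × X × X) : X × X × X :=
  ((S (t.1, t.2.1)).1, (S (t.1, t.2.1)).2, t.2.2)

/-- `S` acting on the second and third components of `X ^ 3`. -/
def act23 (S : X × X → X × X) (t : X × X × X) : X × X × X :=
  (t.1, S t.2)

/-- `(X, S)` is a non-degenerate symmetric (that is, involutive and braided) set-theoretical
solution. -/
structure IsNondegenerateSymmetric (S : X × X → X × X) : Prop where
  g_bijective : ∀ x, Function.Bijective (g S x)
  f_bijective : ∀ x, Function.Bijective (f S x)
  involutive : ∀ p, S (S p) = p
  braided : ∀ t, act12 S (act23 S (act12 S t)) = act23 S (act12 S (act23 S t))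

/-- `(x, y)` is a frozen pair. -/
def IsFrozenPair (S : X × X → X × X) (x y : X) : Prop := S (x, y) = (x, y)

/-- Property (C) for `(X, S)`: it holds for each frozen pair. -/
def PropertyC (S : X × X → X × X) : Prop :=
  ∀ x y, IsFrozenPair S x y → g S x ∘ g S y = id ∧ f S y ∘ f S x = id

/-! ## The structure monoid `M(X,S)` and the structure group `G(X,S)` -/

/-- The relations `x y = g_x(y) f_y(x)`, for `S (x, y) ≠ (x, y)`, between words on `X`. -/
def monoidRels (S : X × X → X × X) (u v : FreeMonoid X) : Prop :=
  ∃ x y, S (x, y) ≠ (x, y) ∧ u = FreeMonoid.of x * FreeMonoid.of y ∧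
    v = FreeMonoid.of (g S x y) * FreeMonoid.of (f S y x)

/-- The same relations in the free group on `X`, written as relators. -/
def groupRels (S : X × X → X × X) : Set (FreeGroup X) :=
  {r | ∃ x y, S (x, y) ≠ (x, y) ∧ r = (FreeGroup.of x * FreeGroup.of y) *
    (FreeGroup.of (g S x y) * FreeGroup.of (f S y x))⁻¹}

/-- The structure monoid `M(X,S)`. -/
abbrev StructureMonoid (S : X × X → X × X) : Type _ := PresentedMonoid (monoidRels S)

/-- The structure group `G(X,S)`. -/
abbrev StructureGroup (S : X × X → X × X) : Type _ := PresentedGroup (groupRels S)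

/-- The canonical morphism from `M(X,S)` to its enveloping group `G(X,S)`. -/
def toStructureGroup (S : X × X → X × X) : StructureMonoid S →* StructureGroup S :=
  PresentedMonoid.lift (fun x => (PresentedGroup.of x : StructureGroup S)) (by
    rintro a b ⟨x, y, hxy, rfl, rfl⟩
    have h : (PresentedGroup.mk (groupRels S)) ((FreeGroup.of x * FreeGroup.of y) *
        (FreeGroup.of (g S x y) * FreeGroup.of (f S y x))⁻¹) = 1 :=
      PresentedGroup.one_of_mem ⟨x, y, hxy, rfl⟩
    rw [map_mul, map_inv, mul_inv_eq_one, map_mul, map_mul] at h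
    simpa [PresentedGroup.of] using h)

end Solutions

/-! ## Garside elements -/

section Garside

variable {M : Type*} [Monoid M]

/-- The set of left divisors of an element; it is `Div(a)` when `a` is balanced. -/
def leftDivisors (a : M) : Set M := {b | ∃ c, a = b * c}

/-- The set of right divisors of an element. -/
def rightDivisors (a : M) : Set M := {b | ∃ c, a = c * b}

/-- `Δ` is balanced and its divisors generate the monoid. -/
def IsGarsideElement (Δ : M) : Prop :=
  leftDivisors Δ = rightDivisors Δ ∧ Submonoid.closure (leftDivisors Δ) = ⊤

/-- `Δ` is "the" Garside element: the least Garside element, for left and right divisibility. -/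
def IsLeastGarsideElement (Δ : M) : Prop :=
  IsGarsideElement Δ ∧
    ∀ Δ' : M, IsGarsideElement Δ' → Δ ∈ leftDivisors Δ' ∧ Δ ∈ rightDivisors Δ'

end Garside

/-! ## Generated groups -/

section GeneratedGroups

variable {W : Type*} [Group W]

/-- The length of `w` on `A`: the minimal length of a word on `A` representing `w` (it is used only
when `A` generates `W` as a monoid). -/
def length (A : Set W) (w : W) : ℕ :=
  sInf {k | ∃ l : List W, (∀ a ∈ l, a ∈ A) ∧ l.prod = w ∧ l.length = k}

/-- The set of left `A`-factors of `w`. -/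
def leftFactors (A : Set W) (w : W) : Set W :=
  {v | ∃ v', w = v * v' ∧ length A w = length A v + length A v'}

/-- The set of right `A`-factors of `w`. -/
def rightFactors (A : Set W) (w : W) : Set W :=
  {v | ∃ v', w = v' * v ∧ length A w = length A v' + length A v}

/-- The defining relations `v v' = v''` of the monoid `M_{w,A}`. The copy of the factor `1` of `w`
stands for the neutral element of the monoid, which is the first constructor. -/
inductive FactorRel (A : Set W) (w : W) :
    FreeMonoid (leftFactors A w) → FreeMonoid (leftFactors A w) → Prop
  | one (e : leftFactors A w) (he : (e : W) = 1) : FactorRel A w (FreeMonoid.of e) 1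
  | mul (v v' v'' : leftFactors A w) (h : (v : W) * v' = v'')
      (hl : length A (v : W) + length A (v' : W) = length A (v'' : W)) :
      FactorRel A w (FreeMonoid.of v * FreeMonoid.of v') (FreeMonoid.of v'')

/-- The monoid `M_{w,A}` (for an `A`-balanced element `w`). -/
abbrev FactorMonoid (A : Set W) (w : W) : Type _ := PresentedMonoid (FactorRel A w)

/-- `(W, A)` is a generating generated group for the monoid `M`, through the `A`-balanced
element `w`. -/
structure IsGeneratingGeneratedGroup (A : Set W) (w : W) (M : Type*) [Monoid M] : Prop where
  finite : Finite W
  generates : Submonoid.closure A = ⊤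
  balanced : leftFactors A w = rightFactors A w
  factors_generate : Subgroup.closure (leftFactors A w) = ⊤
  iso : Nonempty (M ≃* FactorMonoid A w)

/-- `(W, A)` is a generating generated section for the monoid `M`, through the `A`-balanced
element `w`: furthermore every element of `W` is a factor of `w`. -/
structure IsGeneratingGeneratedSection (A : Set W) (w : W) (M : Type*) [Monoid M] : Prop
    extends IsGeneratingGeneratedGroup A w M where
  factors_eq_univ : leftFactors A w = Set.univ

end GeneratedGroups

/-! ## The representation `ψ` and the group `W(X,S)` -/

section Representation

variable {X : Type*} {S : X × X → X × X}

/-- The permutation `φ_x = f_x⁻¹` of `X`. -/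
def phi (hS : IsNondegenerateSymmetric S) (x : X) : Equiv.Perm X :=
  (Equiv.ofBijective (f S x) (hS.f_bijective x)).symm

open Classical in
/-- The sign of `ψ_x` at the basis vector `y`. -/
def psiSign (x y : X) : ℝ := if y = x then -1 else 1

lemma psiSign_mul_self (x y : X) : psiSign x y * psiSign x y = 1 := by
  unfold psiSign; split_ifs <;> norm_num

/-- The linear automorphism `ψ_x` of the real vector space `V = X →₀ ℝ` with basis `X`: it maps the
basis vector `y` to `φ_x(y)` if `y ≠ x`, and the basis vector `x` to `-φ_x(x)`. -/
def psiGen (hS : IsNondegenerateSymmetric S) (x : X) : (X →₀ ℝ) ≃ₗ[ℝ] (X →₀ ℝ) :=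
  LinearEquiv.ofLinearMap
    (Finsupp.linearCombination ℝ fun y => Finsupp.single (phi hS x y) (psiSign x y))
    (Finsupp.linearCombination ℝ fun z =>
      Finsupp.single ((phi hS x).symm z) (psiSign x ((phi hS x).symm z)))
    (by
      ext1 z
      ext1
      simp [psiSign_mul_self])
    (by
      ext1 z
      ext1
      simp [psiSign_mul_self])

lemma psiGen_single (hS : IsNondegenerateSymmetric S) (x y : X) (c : ℝ) :
    psiGen hS x (Finsupp.single y c) = Finsupp.single (phi hS x y) (c * psiSign x y) := by
  simp [psiGen]

lemma phi_mul (hS : IsNondegenerateSymmetric S) (x y : X) :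
    phi hS x * phi hS y = phi hS (g S x y) * phi hS (f S y x) := by
  have key : ∀ t, f S y (f S x t) = f S (f S y x) (f S (g S x y) t) := fun t => by
    have h := congrArg (fun p => p.2.2) (hS.braided (t, x, y))
    simpa [act12, act23, f, g] using h
  apply Equiv.ext
  intro z
  simp only [Equiv.Perm.mul_apply]
  rw [← Equiv.symm_apply_eq, ← Equiv.symm_apply_eq]
  have e : ∀ a b, (phi hS a).symm b = f S a b := fun _ _ => rfl
  have e' : ∀ a b, f S a (phi hS a b) = b := fun a b => (phi hS a).symm_apply_apply b
  rw [e, e, ← key, e', e']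

lemma phi_eq_iff (hS : IsNondegenerateSymmetric S) (x y z : X) :
    phi hS y z = x ↔ z = f S y x := by
  unfold phi
  rw [Equiv.symm_apply_eq]; rfl

lemma psiGen_mul (hS : IsNondegenerateSymmetric S) (x y : X) :
    psiGen hS x * psiGen hS y = psiGen hS (g S x y) * psiGen hS (f S y x) := by
  have hinv : f S (f S y x) (g S x y) = y := by
    have h := congrArg Prod.snd (hS.involutive (x, y))
    simpa [f, g] using h
  apply LinearEquiv.toLinearMap_injective
  ext1 z
  ext1
  have h := Equiv.congr_fun (phi_mul hS x y) z
  simp only [Equiv.Perm.mul_apply] at h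
  have e1 : psiSign x (phi hS y z) = psiSign (f S y x) z := by
    unfold psiSign
    congr 1
    exact propext (phi_eq_iff hS x y z)
  have e2 : psiSign (g S x y) (phi hS (f S y x) z) = psiSign y z := by
    unfold psiSign
    congr 1
    exact propext ((phi_eq_iff hS _ _ z).trans (by rw [hinv]))
  simp [psiGen_single, h, e1, e2, mul_comm]

/-- The representation `ψ : G(X,S) → GL(V)`, with `x ↦ ψ_x`. -/
def psi (hS : IsNondegenerateSymmetric S) :
    StructureGroup S →* ((X →₀ ℝ) ≃ₗ[ℝ] (X →₀ ℝ)) :=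
  PresentedGroup.toGroup (f := psiGen hS) (by
    rintro r ⟨x, y, -, rfl⟩
    simp only [map_mul, map_inv, FreeGroup.lift_apply_of, mul_inv_eq_one]
    exact psiGen_mul hS x y)

/-- The group `W(X,S)`, the image of `ψ` in `GL(V)`. -/
def groupW (hS : IsNondegenerateSymmetric S) : Subgroup ((X →₀ ℝ) ≃ₗ[ℝ] (X →₀ ℝ)) :=
  (psi hS).range

/-- The morphism `ψ : M(X,S) → W(X,S)`. -/
def psiMonoid (hS : IsNondegenerateSymmetric S) : StructureMonoid S →* groupW hS :=
  (psi hS).rangeRestrict.comp (toStructureGroup S)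

/-- The generating set `{ψ_x | x ∈ X}` of `W(X,S)`. -/
def generatorsW (hS : IsNondegenerateSymmetric S) : Set (groupW hS) :=
  Set.range fun x => psiMonoid hS (PresentedMonoid.of (monoidRels S) x)

end Representation

end YangBaxter

end

/-!
Each frozen pair is of the form `(T y, y)`, where `T y = φ_y(y)` is a permutation of `X`. Letting
`x` act on multisets by `s ↦ f_x(s) + {x}` gives a 1-cocycle from `M(X,S)` to the multisets on `X`.
It is bijective: the elements of `M(X,S)` are built from `1` by commuting operators, each of which
adds one point to the cocycle. Hence a monoid element is determined by a multiset, right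
divisibility is inclusion of multisets, and the Garside element `Δ` corresponds to `X` itself; its
divisors are the elements with a multiplicity free cocycle, which we call simple.

On the basis vector `y`, the automorphism `ψ(m)` is a permutation followed by the sign
`(-1) ^ k`, with `k` the multiplicity of `y` in the cocycle of `m`. A simple element therefore has
the smallest cocycle in its fibre under `ψ`, so `ψ` is injective on simple elements and turns the
length on `M(X,S)` into the length on `W`. The cocycle of a frozen element `T(y) y` is `{y, y}`,
and property `(C)` says exactly that `ψ` kills these elements: it is what allows one to reduce any
element to a simple one without changing its image.
-/

namespace YangBaxter

section Monoids

variable {M : Type*} [Monoid M]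

lemma mem_of_irreducible_of_closure_eq_top [Subsingleton Mˣ] {s : Set M}
    (hs : Submonoid.closure s = ⊤) {a : M} (ha : Irreducible a) : a ∈ s := by
  have ha_mem : a ∈ Submonoid.closure s := hs ▸ Submonoid.mem_top a
  induction ha_mem using Submonoid.closure_induction with
  | mem a h => exact h
  | one => exact absurd isUnit_one ha.not_isUnit
  | mul b c _ _ hb hc =>
    rcases ha.isUnit_or_isUnit rfl with h | h <;> obtain rfl := h.eq_one <;> simp_all

lemma neg_one_pow_eq_neg_one_pow_iff [HasDistribNeg M] (h : (-1 : M) ≠ 1) {a b : ℕ} :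
    (-1 : M) ^ a = (-1) ^ b ↔ (Even a ↔ Even b) := by
  rw [neg_one_pow_eq_ite, neg_one_pow_eq_ite]
  split_ifs <;> grind

end Monoids

section Length

variable {W : Type*} [Group W] {A : Set W}

lemma length_prod_le {l : List W} (hl : ∀ a ∈ l, a ∈ A) : length A l.prod ≤ l.length :=
  Nat.sInf_le ⟨l, hl, rfl, rfl⟩

lemma exists_list_length_eq {w : W} (hw : w ∈ Submonoid.closure A) :
    ∃ l : List W, (∀ a ∈ l, a ∈ A) ∧ l.prod = w ∧ l.length = length A w := by
  obtain ⟨l, hl, hprod⟩ := Submonoid.exists_list_of_mem_closure hw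
  exact Nat.sInf_mem
    (s := {k | ∃ l : List W, (∀ a ∈ l, a ∈ A) ∧ l.prod = w ∧ l.length = k})
    ⟨_, l, hl, hprod, rfl⟩

end Length

section Solution

variable {X : Type*} {S : X × X → X × X} (hS : IsNondegenerateSymmetric S)

include hS in
lemma f_f_g (x y : X) : f S (f S y x) (g S x y) = y :=
  congrArg Prod.snd (hS.involutive (x, y))

lemma phi_f_eq_g (x y : X) : phi hS (f S y x) y = g S x y :=
  (phi_eq_iff hS _ _ _).2 (f_f_g hS x y).symm

lemma f_phi (x y : X) : f S y (phi hS y x) = x :=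
  ((phi_eq_iff hS _ _ _).1 rfl).symm

lemma g_phi (x y : X) : g S (phi hS y x) y = phi hS x y := by
  rw [← phi_f_eq_g hS, f_phi]

include hS in
lemma isFrozenPair_iff_g_eq (x y : X) : IsFrozenPair S x y ↔ g S x y = x := by
  refine ⟨congrArg Prod.fst, fun h => ?_⟩
  have hS_xy : S (x, y) = (x, f S y x) := Prod.ext h rfl
  have h_swap : S (x, f S y x) = (x, y) := hS_xy ▸ hS.involutive (x, y)
  have h_f : f S y x = y :=
    (hS.g_bijective x).injective ((congrArg Prod.fst h_swap).trans h.symm)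
  exact hS_xy.trans (by rw [h_f])

/-- The map `T : x ↦ φ_x(x)`, whose graph is the set of frozen pairs read from right to left. -/
noncomputable def diag (x : X) : X := phi hS x x

lemma isFrozenPair_iff_diag_eq (x y : X) : IsFrozenPair S x y ↔ diag hS y = x := by
  rw [diag, phi_eq_iff]
  refine ⟨fun h => (congrArg Prod.snd h).symm, fun h => ?_⟩
  have h_g := phi_f_eq_g hS x y
  rw [← h] at h_g
  exact (isFrozenPair_iff_g_eq hS x y).2 (h_g.symm.trans ((phi_eq_iff hS _ _ _).2 h))

lemma diag_bijective : Function.Bijective (diag hS) := by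
  have g_diag (y : X) : g S (diag hS y) y = diag hS y :=
    (isFrozenPair_iff_g_eq hS _ _).1 ((isFrozenPair_iff_diag_eq hS _ _).2 rfl)
  refine ⟨fun y z h => (hS.g_bijective (diag hS y)).injective ?_, fun x => ?_⟩
  · rw [g_diag, h, g_diag]
  · obtain ⟨y, hy⟩ := (hS.g_bijective x).surjective x
    exact ⟨y, (isFrozenPair_iff_diag_eq hS x y).1 ((isFrozenPair_iff_g_eq hS x y).2 hy)⟩

lemma diag_g (x y : X) : diag hS (g S x y) = phi hS x (diag hS y) := by
  rw [diag, diag, ← Equiv.Perm.mul_apply, phi_mul, Equiv.Perm.mul_apply, phi_f_eq_g]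

lemma propertyC_iff_phi_mul_phi :
    PropertyC S ↔ ∀ x y, IsFrozenPair S x y → phi hS x * phi hS y = 1 := by
  have f_comp_f (x y : X) : f S y ∘ f S x = id ↔ phi hS x * phi hS y = 1 := by
    rw [← inv_eq_one, mul_inv_rev]
    exact ⟨fun h => Equiv.ext (congrFun h), fun h => funext (Equiv.congr_fun h)⟩
  refine forall₃_congr fun x y _ => ⟨fun h => (f_comp_f x y).1 h.2, fun h => ⟨?_, ?_⟩⟩
  · funext z
    apply (diag_bijective hS).injective
    rw [Function.comp_apply, diag_g, diag_g, ← Equiv.Perm.mul_apply, h]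
    rfl
  · exact (f_comp_f x y).2 h

end Solution

section Cocycle

variable {X : Type*} {S : X × X → X × X} (hS : IsNondegenerateSymmetric S)

/-- The generator of `M(X,S)` attached to `x`. -/
abbrev gen (S : X × X → X × X) (x : X) : StructureMonoid S :=
  PresentedMonoid.of (monoidRels S) x

lemma gen_mul_gen (x y : X) : gen S x * gen S y = gen S (g S x y) * gen S (f S y x) := by
  by_cases h : S (x, y) = (x, y)
  · simp only [g, f, h]
  · exact PresentedMonoid.mk_eq_mk_of_rel ⟨x, y, h, rfl, rfl⟩

@[elab_as_elim]
lemma gen_induction {p : StructureMonoid S → Prop} (one : p 1)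
    (mul : ∀ x m, p m → p (gen S x * m)) (m : StructureMonoid S) : p m :=
  Submonoid.induction_of_closure_eq_top_left (PresentedMonoid.closure_range_of (monoidRels S)) m
    one (by rintro _ ⟨x, rfl⟩; exact mul x)

lemma gen_phi_mul_gen (x y : X) :
    gen S (phi hS x y) * gen S x = gen S (phi hS y x) * gen S y := by
  rw [gen_mul_gen, g_phi, f_phi]

/-- The morphism `M(X,S) → Sym(X)` extending `x ↦ φ_x`. -/
noncomputable def phiHom : StructureMonoid S →* Equiv.Perm X :=
  PresentedMonoid.lift (phi hS) (by
    rintro _ _ ⟨x, y, -, rfl, rfl⟩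
    simpa only [map_mul, FreeMonoid.lift_eval_of] using phi_mul hS x y)

@[simp]
lemma phiHom_gen (x : X) : phiHom hS (gen S x) = phi hS x := rfl

/-- The right action of `M(X,S)` on the multisets on `X`, where `x` acts by `s ↦ f_x(s) + {x}`. A
right action is encoded as a morphism to the opposite of the monoid of self-maps. -/
noncomputable def multisetAction : StructureMonoid S →* (Function.End (Multiset X))ᵐᵒᵖ :=
  PresentedMonoid.lift (M := (Function.End (Multiset X))ᵐᵒᵖ)
    (fun x => MulOpposite.op fun s => x ::ₘ s.map (f S x)) (by
    rintro _ _ ⟨x, y, -, rfl, rfl⟩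
    refine MulOpposite.unop_injective (funext fun s => ?_)
    have f_comp (t : X) : f S y (f S x t) = f S (f S y x) (f S (g S x y) t) :=
      congrArg (fun p => p.2.2) (hS.braided (t, x, y))
    change y ::ₘ (x ::ₘ s.map (f S x)).map (f S y) =
      f S y x ::ₘ (g S x y ::ₘ s.map (f S (g S x y))).map (f S (f S y x))
    simp [f_comp, f_f_g hS, Multiset.cons_swap y])

/-- The cocycle of `m`: the image of the empty multiset under the right action of `m`. -/
noncomputable def cocycle (m : StructureMonoid S) : Multiset X := (multisetAction hS m).unop 0

@[simp]
lemma cocycle_one : cocycle hS 1 = 0 := by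
  simp [cocycle, Function.End.one_def]

@[simp]
lemma cocycle_gen (x : X) : cocycle hS (gen S x) = {x} := rfl

lemma multisetAction_apply (m : StructureMonoid S) (s : Multiset X) :
    (multisetAction hS m).unop s = s.map (phiHom hS m).symm + cocycle hS m := by
  induction m using gen_induction generalizing s with
  | one => simp [Function.End.one_def, Equiv.Perm.one_def]
  | mul x m ih =>
    have action_gen_mul (t : Multiset X) : (multisetAction hS (gen S x * m)).unop t =
        (multisetAction hS m).unop (x ::ₘ t.map (f S x)) := by rw [map_mul]; rfl
    rw [cocycle, action_gen_mul, action_gen_mul, ih, ih, map_mul]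
    simp only [Multiset.map_cons, Multiset.map_map, Multiset.map_zero, Multiset.cons_add,
      Multiset.add_cons, zero_add]
    rfl

lemma cocycle_mul (m n : StructureMonoid S) :
    cocycle hS (m * n) = (cocycle hS m).map (phiHom hS n).symm + cocycle hS n := by
  rw [← multisetAction_apply, cocycle, map_mul]
  rfl

lemma cocycle_gen_mul (x : X) (m : StructureMonoid S) :
    cocycle hS (gen S x * m) = (phiHom hS m).symm x ::ₘ cocycle hS m := by
  rw [cocycle_mul, cocycle_gen, Multiset.map_singleton, Multiset.singleton_add]

lemma card_cocycle_mul (m n : StructureMonoid S) :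
    (cocycle hS (m * n)).card = (cocycle hS m).card + (cocycle hS n).card := by
  rw [cocycle_mul, Multiset.card_add, Multiset.card_map]

lemma card_cocycle_list_prod (l : List X) :
    (cocycle hS (l.map (gen S)).prod).card = l.length := by
  induction l with
  | nil => simp
  | cons x l ih =>
    rw [List.map_cons, List.prod_cons, cocycle_gen_mul, Multiset.card_cons, ih, List.length_cons]

/-- Left multiplication of `m` by the generator that adds the point `p` to the cocycle. -/
noncomputable def adjoin (p : X) (m : StructureMonoid S) : StructureMonoid S :=
  gen S (phiHom hS m p) * m

lemma cocycle_adjoin (p : X) (m : StructureMonoid S) :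
    cocycle hS (adjoin hS p m) = p ::ₘ cocycle hS m := by
  rw [adjoin, cocycle_gen_mul, Equiv.symm_apply_apply]

lemma adjoin_symm_phiHom (x : X) (m : StructureMonoid S) :
    adjoin hS ((phiHom hS m).symm x) m = gen S x * m := by
  rw [adjoin, Equiv.apply_symm_apply]

instance leftCommutative_adjoin : LeftCommutative (adjoin hS) where
  left_comm p q m := by
    simp only [adjoin, map_mul, phiHom_gen, Equiv.Perm.mul_apply, ← mul_assoc]
    rw [gen_phi_mul_gen]

/-- The cocycle as a bijection between `M(X,S)` and the multisets on `X`. -/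
noncomputable def cocycleEquiv : StructureMonoid S ≃ Multiset X where
  toFun := cocycle hS
  invFun := Multiset.foldr (adjoin hS) 1
  left_inv m := by
    induction m using gen_induction with
    | one => rw [cocycle_one, Multiset.foldr_zero]
    | mul x m ih => rw [cocycle_gen_mul, Multiset.foldr_cons, ih, adjoin_symm_phiHom]
  right_inv s := by
    induction s using Multiset.induction with
    | empty => rw [Multiset.foldr_zero, cocycle_one]
    | cons p s ih => rw [Multiset.foldr_cons, cocycle_adjoin, ih]

lemma cocycle_injective : Function.Injective (cocycle hS) := (cocycleEquiv hS).injective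

lemma cocycle_surjective : Function.Surjective (cocycle hS) := (cocycleEquiv hS).surjective

@[simp]
lemma cocycle_eq_zero_iff {m : StructureMonoid S} : cocycle hS m = 0 ↔ m = 1 := by
  rw [← cocycle_one hS, (cocycle_injective hS).eq_iff]

lemma mem_rightDivisors_iff {a b : StructureMonoid S} :
    b ∈ rightDivisors a ↔ cocycle hS b ≤ cocycle hS a := by
  constructor
  · rintro ⟨c, rfl⟩
    rw [cocycle_mul]
    exact Multiset.le_add_left _ _
  · intro h
    obtain ⟨s, hs⟩ := Multiset.le_iff_exists_add.1 h
    obtain ⟨c, hc⟩ := cocycle_surjective hS (s.map (phiHom hS b))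
    refine ⟨c, cocycle_injective hS ?_⟩
    simp [cocycle_mul, hs, hc, add_comm]

include hS in
lemma subsingleton_units : Subsingleton (StructureMonoid S)ˣ := by
  refine Subsingleton.units_of_isUnit fun a ha => ?_
  obtain ⟨b, hab⟩ := ha.exists_right_inv
  have h_card := card_cocycle_mul hS a b
  rw [hab, cocycle_one, Multiset.card_zero] at h_card
  rw [← cocycle_eq_zero_iff hS, ← Multiset.card_eq_zero]
  omega

include hS in
lemma irreducible_gen (x : X) : Irreducible (gen S x) := by
  have := subsingleton_units hS
  simp only [irreducible_iff, isUnit_iff_eq_one, ← cocycle_eq_zero_iff hS, ← Multiset.card_eq_zero]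
  refine ⟨by simp, fun a b h => ?_⟩
  have h_card := card_cocycle_mul hS a b
  rw [← h, cocycle_gen, Multiset.card_singleton] at h_card
  omega

/-- The left-handed analogue of the cocycle, with `x` acting on the left by
`s ↦ φ_x(s + {x})`. -/
noncomputable def leftCocycle (m : StructureMonoid S) : Multiset X :=
  (cocycle hS m).map (phiHom hS m)

lemma leftCocycle_mul (m n : StructureMonoid S) :
    leftCocycle hS (m * n) = leftCocycle hS m + (leftCocycle hS n).map (phiHom hS m) := by
  simp [leftCocycle, cocycle_mul]

lemma leftCocycle_mul_gen (m : StructureMonoid S) (x : X) :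
    leftCocycle hS (m * gen S x) = phiHom hS m (diag hS x) ::ₘ leftCocycle hS m := by
  rw [leftCocycle_mul, add_comm, ← Multiset.singleton_add]
  rfl

lemma leftCocycle_surjective : Function.Surjective (leftCocycle hS) := by
  intro s
  induction s using Multiset.induction with
  | empty => exact ⟨1, by simp [leftCocycle]⟩
  | cons p s ih =>
    obtain ⟨m, rfl⟩ := ih
    obtain ⟨x, hx⟩ := (diag_bijective hS).surjective ((phiHom hS m).symm p)
    exact ⟨m * gen S x, by rw [leftCocycle_mul_gen, hx, Equiv.apply_symm_apply]⟩

end Cocycle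

section Representation

variable {X : Type*} {S : X × X → X × X} (hS : IsNondegenerateSymmetric S)

lemma psi_single [DecidableEq X] (m : StructureMonoid S) (y : X) (c : ℝ) :
    psi hS (toStructureGroup S m) (Finsupp.single y c) =
      Finsupp.single (phiHom hS m y) (c * (-1) ^ (cocycle hS m).count y) := by
  induction m using gen_induction with
  | one => simp
  | mul x m ih =>
    have psi_gen : psi hS (toStructureGroup S (gen S x)) = psiGen hS x :=
      PresentedGroup.toGroup.of _
    rw [map_mul, map_mul, LinearEquiv.mul_apply, ih, psi_gen, psiGen_single, map_mul, phiHom_gen,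
      cocycle_gen_mul, Multiset.count_cons]
    simp only [Equiv.eq_symm_apply, psiSign, Equiv.Perm.mul_apply]
    split_ifs <;> simp [pow_succ]

lemma psiMonoid_eq_iff [DecidableEq X] (m n : StructureMonoid S) :
    psiMonoid hS m = psiMonoid hS n ↔ phiHom hS m = phiHom hS n ∧
      ∀ y, Even ((cocycle hS m).count y) ↔ Even ((cocycle hS n).count y) := by
  have neg_one_ne_one : (-1 : ℝ) ≠ 1 := by norm_num
  have psi_single_eq_iff (y : X) : psi hS (toStructureGroup S m) (Finsupp.single y 1) =
      psi hS (toStructureGroup S n) (Finsupp.single y 1) ↔ phiHom hS m y = phiHom hS n y ∧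
        (Even ((cocycle hS m).count y) ↔ Even ((cocycle hS n).count y)) := by
    simp [psi_single, Finsupp.single_eq_single_iff,
      neg_one_pow_eq_neg_one_pow_iff neg_one_ne_one]
  have psi_eq_iff : psiMonoid hS m = psiMonoid hS n ↔ ∀ y,
      psi hS (toStructureGroup S m) (Finsupp.single y 1) =
        psi hS (toStructureGroup S n) (Finsupp.single y 1) := by
    rw [Subtype.ext_iff, ← LinearEquiv.toLinearMap_inj, Finsupp.lhom_ext'_iff]
    exact forall_congr' fun y => LinearMap.ext_ring_iff
  rw [psi_eq_iff, Equiv.ext_iff, ← forall_and]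
  exact forall_congr' psi_single_eq_iff

lemma mrange_psiMonoid :
    MonoidHom.mrange (psiMonoid hS) = Submonoid.closure (generatorsW hS) := by
  rw [MonoidHom.mrange_eq_map, ← PresentedMonoid.closure_range_of, MonoidHom.map_mclosure,
    ← Set.range_comp]
  rfl

end Representation

section Simple

variable {X : Type*} {S : X × X → X × X} (hS : IsNondegenerateSymmetric S)

/-- An element of `M(X,S)` is simple when its cocycle is multiplicity free. If `X` is finite, the
simple elements are the divisors of the Garside element. -/
def IsSimple (m : StructureMonoid S) : Prop := (cocycle hS m).Nodup

lemma isSimple_one : IsSimple hS 1 := by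
  simp [IsSimple]

lemma isSimple_gen (x : X) : IsSimple hS (gen S x) := by
  simp [IsSimple]

lemma isSimple_gen_mul_gen {x y : X} (h : ¬IsFrozenPair S x y) :
    IsSimple hS (gen S x * gen S y) := by
  rw [isFrozenPair_iff_diag_eq hS, diag, eq_comm, ← Equiv.symm_apply_eq] at h
  simpa [IsSimple, cocycle_gen_mul] using h

lemma finite_setOf_isSimple [Finite X] : {m | IsSimple hS m}.Finite := by
  refine Set.Finite.preimage (cocycle_injective hS).injOn ((Set.finite_range Finset.val).subset ?_)
  exact fun s hs => ⟨⟨s, hs⟩, rfl⟩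

variable {hS} {m n : StructureMonoid S}

lemma IsSimple.of_mul_left (h : IsSimple hS (m * n)) : IsSimple hS m := by
  rw [IsSimple, cocycle_mul] at h
  exact (Multiset.nodup_of_le (Multiset.le_add_right _ _) h).of_map _

lemma IsSimple.of_mul_right (h : IsSimple hS (m * n)) : IsSimple hS n :=
  Multiset.nodup_of_le ((mem_rightDivisors_iff hS).1 ⟨m, rfl⟩) h

lemma IsSimple.cocycle_le (hm : IsSimple hS m) (h : psiMonoid hS m = psiMonoid hS n) :
    cocycle hS m ≤ cocycle hS n := by
  classical
  refine Multiset.le_iff_count.2 fun y => ?_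
  have count_parity := ((psiMonoid_eq_iff hS m n).1 h).2 y
  have count_le_one := Multiset.nodup_iff_count_le_one.1 hm y
  grind

lemma IsSimple.eq_of_card_le (hm : IsSimple hS m) (h : psiMonoid hS m = psiMonoid hS n)
    (h_card : (cocycle hS n).card ≤ (cocycle hS m).card) : m = n :=
  cocycle_injective hS (Multiset.eq_of_le_of_card_le (hm.cocycle_le h) h_card)

lemma IsSimple.eq (hm : IsSimple hS m) (hn : IsSimple hS n)
    (h : psiMonoid hS m = psiMonoid hS n) : m = n :=
  cocycle_injective hS (le_antisymm (hm.cocycle_le h) (hn.cocycle_le h.symm))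

end Simple

section LengthW

variable {X : Type*} {S : X × X → X × X} (hS : IsNondegenerateSymmetric S)

lemma length_psiMonoid_le (m : StructureMonoid S) :
    length (generatorsW hS) (psiMonoid hS m) ≤ (cocycle hS m).card := by
  obtain ⟨l, rfl⟩ : ∃ l : List X, (l.map (gen S)).prod = m := by
    induction m using gen_induction with
    | one => exact ⟨[], rfl⟩
    | mul x m ih =>
      obtain ⟨l, rfl⟩ := ih
      exact ⟨x :: l, rfl⟩
  rw [map_list_prod, List.map_map, card_cocycle_list_prod]
  refine (length_prod_le fun a ha => ?_).trans_eq (List.length_map _)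
  obtain ⟨x, -, rfl⟩ := List.mem_map.1 ha
  exact ⟨x, rfl⟩

lemma exists_psiMonoid_eq_card_eq_length {w : groupW hS}
    (hw : w ∈ Submonoid.closure (generatorsW hS)) :
    ∃ m, psiMonoid hS m = w ∧ (cocycle hS m).card = length (generatorsW hS) w := by
  obtain ⟨l, hl_mem, hl_prod, hl_length⟩ := exists_list_length_eq hw
  obtain ⟨l, rfl⟩ : l ∈ Set.range (List.map fun x => psiMonoid hS (gen S x)) := by
    rwa [Set.range_list_map]
  refine ⟨(l.map (gen S)).prod, ?_, ?_⟩
  · rw [map_list_prod, List.map_map, ← hl_prod]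
    rfl
  · rw [card_cocycle_list_prod, ← hl_length, List.length_map]

variable {hS} {a m n : StructureMonoid S}

lemma IsSimple.length_psiMonoid (hm : IsSimple hS m) :
    length (generatorsW hS) (psiMonoid hS m) = (cocycle hS m).card := by
  refine (length_psiMonoid_le hS m).antisymm ?_
  have mem_closure : psiMonoid hS m ∈ Submonoid.closure (generatorsW hS) :=
    mrange_psiMonoid hS ▸ ⟨m, rfl⟩
  obtain ⟨n, hn, hn_card⟩ := exists_psiMonoid_eq_card_eq_length hS mem_closure
  rw [← hn_card]
  exact Multiset.card_le_card (hm.cocycle_le hn.symm)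

lemma IsSimple.length_psiMonoid_mul (h : IsSimple hS (m * n)) :
    length (generatorsW hS) (psiMonoid hS (m * n)) =
      length (generatorsW hS) (psiMonoid hS m) + length (generatorsW hS) (psiMonoid hS n) := by
  rw [h.length_psiMonoid, h.of_mul_left.length_psiMonoid, h.of_mul_right.length_psiMonoid,
    card_cocycle_mul]

lemma IsSimple.exists_mul_eq (hgen : Submonoid.closure (generatorsW hS) = ⊤)
    (ha : IsSimple hS a) {v v' : groupW hS} (hw : psiMonoid hS a = v * v')
    (hl : length (generatorsW hS) (psiMonoid hS a) =
      length (generatorsW hS) v + length (generatorsW hS) v') :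
    ∃ m n, a = m * n ∧ psiMonoid hS m = v ∧ psiMonoid hS n = v' := by
  have exists_lift (u : groupW hS) := exists_psiMonoid_eq_card_eq_length (w := u) hS
    (hgen ▸ Submonoid.mem_top u)
  obtain ⟨m, hm, hm_card⟩ := exists_lift v
  obtain ⟨n, hn, hn_card⟩ := exists_lift v'
  refine ⟨m, n, ha.eq_of_card_le ?_ ?_, hm, hn⟩
  · rw [hw, map_mul, hm, hn]
  · rw [card_cocycle_mul, hm_card, hn_card, ← hl, ha.length_psiMonoid]

lemma IsSimple.leftFactors_psiMonoid (hgen : Submonoid.closure (generatorsW hS) = ⊤)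
    (ha : IsSimple hS a) :
    leftFactors (generatorsW hS) (psiMonoid hS a) = psiMonoid hS '' leftDivisors a := by
  ext v
  constructor
  · rintro ⟨v', hw, hl⟩
    obtain ⟨m, n, h_mul, rfl, -⟩ := ha.exists_mul_eq hgen hw hl
    exact ⟨m, ⟨n, h_mul⟩, rfl⟩
  · rintro ⟨m, ⟨n, rfl⟩, rfl⟩
    exact ⟨psiMonoid hS n, map_mul _ _ _, ha.length_psiMonoid_mul⟩

lemma IsSimple.rightFactors_psiMonoid (hgen : Submonoid.closure (generatorsW hS) = ⊤)
    (ha : IsSimple hS a) :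
    rightFactors (generatorsW hS) (psiMonoid hS a) = psiMonoid hS '' rightDivisors a := by
  ext v
  constructor
  · rintro ⟨v', hw, hl⟩
    obtain ⟨m, n, h_mul, -, rfl⟩ := ha.exists_mul_eq hgen hw hl
    exact ⟨n, ⟨m, h_mul⟩, rfl⟩
  · rintro ⟨n, ⟨m, rfl⟩, rfl⟩
    exact ⟨psiMonoid hS m, map_mul _ _ _, ha.length_psiMonoid_mul⟩

end LengthW

section GarsideElement

variable {X : Type*} [Fintype X] {S : X × X → X × X} (hS : IsNondegenerateSymmetric S)

/-- The Garside element of `M(X,S)`: the element whose cocycle is `X`. -/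
noncomputable def garsideElement : StructureMonoid S :=
  (cocycleEquiv hS).symm Finset.univ.val

lemma cocycle_garsideElement : cocycle hS (garsideElement hS) = Finset.univ.val :=
  (cocycleEquiv hS).apply_symm_apply _

lemma isSimple_garsideElement : IsSimple hS (garsideElement hS) := by
  rw [IsSimple, cocycle_garsideElement]
  exact Finset.univ.nodup

lemma rightDivisors_garsideElement :
    rightDivisors (garsideElement hS) = {m | IsSimple hS m} := by
  ext m
  rw [mem_rightDivisors_iff hS, cocycle_garsideElement]
  exact ⟨fun h => Multiset.nodup_of_le h Finset.univ.nodup,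
    fun h => (Multiset.le_iff_subset h).2 fun x _ => Finset.mem_univ x⟩

lemma leftDivisors_garsideElement :
    leftDivisors (garsideElement hS) = {m | IsSimple hS m} := by
  refine Set.Subset.antisymm ?_ fun m (hm : IsSimple hS m) => ?_
  · rintro m ⟨c, hc⟩
    exact IsSimple.of_mul_left (n := c) (hc ▸ isSimple_garsideElement hS)
  have leftCocycle_nodup : (leftCocycle hS m).Nodup := hm.map (phiHom hS m).injective
  obtain ⟨s, hs⟩ := Multiset.le_iff_exists_add.1 <|
    (Multiset.le_iff_subset leftCocycle_nodup).2 fun x _ => Finset.mem_univ x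
  obtain ⟨c, hc⟩ := leftCocycle_surjective hS (s.map (phiHom hS m).symm)
  have leftCocycle_eq_univ : leftCocycle hS (m * c) = Finset.univ.val := by
    simp [leftCocycle_mul, hc, hs]
  refine ⟨c, cocycle_injective hS ?_⟩
  apply Multiset.map_injective (phiHom hS (m * c)).injective
  rw [cocycle_garsideElement, Multiset.map_univ_val_equiv]
  exact leftCocycle_eq_univ.symm

lemma isGarsideElement_garsideElement : IsGarsideElement (garsideElement hS) := by
  have range_gen_subset : Set.range (gen S) ⊆ leftDivisors (garsideElement hS) := by
    rw [leftDivisors_garsideElement]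
    rintro _ ⟨x, rfl⟩
    exact isSimple_gen hS x
  refine ⟨?_, top_unique ?_⟩
  · rw [leftDivisors_garsideElement, rightDivisors_garsideElement]
  · rw [← PresentedMonoid.closure_range_of]
    exact Submonoid.closure_mono range_gen_subset

lemma isLeastGarsideElement_garsideElement : IsLeastGarsideElement (garsideElement hS) := by
  refine ⟨isGarsideElement_garsideElement hS, fun Δ hΔ => ?_⟩
  suffices garsideElement hS ∈ rightDivisors Δ from ⟨hΔ.1 ▸ this, this⟩
  have := subsingleton_units hS
  rw [mem_rightDivisors_iff hS, cocycle_garsideElement, Multiset.le_iff_subset Finset.univ.nodup]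
  intro x _
  have gen_mem : gen S x ∈ rightDivisors Δ :=
    hΔ.1 ▸ mem_of_irreducible_of_closure_eq_top hΔ.2 (irreducible_gen hS x)
  simpa [mem_rightDivisors_iff hS] using gen_mem

variable {hS} in
lemma IsLeastGarsideElement.eq_garsideElement {Δ : StructureMonoid S}
    (hΔ : IsLeastGarsideElement Δ) : Δ = garsideElement hS := by
  have least := isLeastGarsideElement_garsideElement hS
  refine cocycle_injective hS (le_antisymm ?_ ?_) <;> rw [← mem_rightDivisors_iff]
  · exact (hΔ.2 _ least.1).2
  · exact (least.2 _ hΔ.1).2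

end GarsideElement

section PropertyC

variable {X : Type*} {S : X × X → X × X} (hS : IsNondegenerateSymmetric S)

lemma cocycle_gen_diag_mul_gen (y : X) : cocycle hS (gen S (diag hS y) * gen S y) = {y, y} := by
  rw [cocycle_gen_mul, cocycle_gen, phiHom_gen, diag, Equiv.symm_apply_apply]
  rfl

lemma even_count_cocycle_gen_diag_mul_gen [DecidableEq X] (y z : X) :
    Even ((cocycle hS (gen S (diag hS y) * gen S y)).count z) := by
  rw [cocycle_gen_diag_mul_gen]
  by_cases h : z = y <;> simp [h]

lemma propertyC_iff_psiMonoid_frozen :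
    PropertyC S ↔ ∀ x y, IsFrozenPair S x y → psiMonoid hS (gen S x * gen S y) = 1 := by
  classical
  rw [propertyC_iff_phi_mul_phi hS]
  refine forall₃_congr fun x y hxy => ?_
  obtain rfl := (isFrozenPair_iff_diag_eq hS x y).1 hxy
  rw [← map_one (psiMonoid hS), psiMonoid_eq_iff]
  simp [even_count_cocycle_gen_diag_mul_gen]

variable {hS}

lemma PropertyC.psiMonoid_gen_diag_mul_gen (hC : PropertyC S) (y : X) :
    psiMonoid hS (gen S (diag hS y) * gen S y) = 1 :=
  (propertyC_iff_psiMonoid_frozen hS).1 hC _ _ ((isFrozenPair_iff_diag_eq hS _ _).2 rfl)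

lemma PropertyC.exists_isSimple (hC : PropertyC S) (m : StructureMonoid S) :
    ∃ n, IsSimple hS n ∧ psiMonoid hS n = psiMonoid hS m := by
  induction h_card : (cocycle hS m).card using Nat.strong_induction_on generalizing m with
  | _ k ih =>
    by_cases hm : IsSimple hS m
    · exact ⟨m, hm, rfl⟩
    obtain ⟨y, hy⟩ : ∃ y, {y, y} ≤ cocycle hS m := by
      simpa [IsSimple, Multiset.nodup_iff_le] using hm
    rw [← cocycle_gen_diag_mul_gen hS, ← mem_rightDivisors_iff] at hy
    obtain ⟨c, rfl⟩ := hy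
    rw [card_cocycle_mul, cocycle_gen_diag_mul_gen, Multiset.card_pair] at h_card
    obtain ⟨n, hn, hn_psi⟩ := ih (cocycle hS c).card (by omega) c rfl
    exact ⟨n, hn, by rw [hn_psi, map_mul, hC.psiMonoid_gen_diag_mul_gen, mul_one]⟩

lemma PropertyC.inv_generatorsW_subset (hC : PropertyC S) :
    (generatorsW hS)⁻¹ ⊆ generatorsW hS := by
  rw [Set.inv_subset]
  rintro _ ⟨x, rfl⟩
  obtain ⟨y, rfl⟩ := (diag_bijective hS).surjective x
  refine ⟨y, eq_inv_of_mul_eq_one_right ?_⟩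
  rw [← map_mul]
  exact hC.psiMonoid_gen_diag_mul_gen y

variable (hS) in
lemma subgroupClosure_generatorsW : Subgroup.closure (generatorsW hS) = ⊤ := by
  have map_closure := (psi hS).rangeRestrict.map_closure (Set.range PresentedGroup.of)
  rw [PresentedGroup.closure_range_of, ← Set.range_comp,
    Subgroup.map_top_of_surjective _ (psi hS).rangeRestrict_surjective] at map_closure
  exact map_closure.symm

lemma PropertyC.closure_generatorsW (hC : PropertyC S) :
    Submonoid.closure (generatorsW hS) = ⊤ := by
  rw [← Set.union_eq_self_of_subset_right hC.inv_generatorsW_subset,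
    ← Subgroup.closure_toSubmonoid, subgroupClosure_generatorsW, Subgroup.top_toSubmonoid]

lemma PropertyC.exists_isSimple_psiMonoid_eq (hC : PropertyC S) (w : groupW hS) :
    ∃ m, IsSimple hS m ∧ psiMonoid hS m = w := by
  obtain ⟨m, rfl⟩ : w ∈ MonoidHom.mrange (psiMonoid hS) := by
    rw [mrange_psiMonoid, hC.closure_generatorsW]
    exact Submonoid.mem_top w
  exact hC.exists_isSimple m

lemma IsSimple.eq_one_of_even_count [DecidableEq X] {m : StructureMonoid S} (hm : IsSimple hS m)
    (h : ∀ y, Even ((cocycle hS m).count y)) : m = 1 := by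
  rw [← cocycle_eq_zero_iff hS, Multiset.eq_zero_iff_forall_notMem]
  intro y
  have count_le_one := Multiset.nodup_iff_count_le_one.1 hm y
  rw [← Multiset.count_eq_zero]
  grind

variable (hS) in
lemma image_isSimple_eq_univ_iff :
    psiMonoid hS '' {m | IsSimple hS m} = Set.univ ↔ PropertyC S := by
  classical
  refine ⟨fun h => (propertyC_iff_psiMonoid_frozen hS).2 fun x y hxy => ?_, fun hC =>
    Set.eq_univ_of_forall hC.exists_isSimple_psiMonoid_eq⟩
  obtain rfl := (isFrozenPair_iff_diag_eq hS x y).1 hxy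
  obtain ⟨m, hm, hm_psi⟩ := h.symm ▸ Set.mem_univ (psiMonoid hS (gen S (diag hS y) * gen S y))
  have even_count (z : X) : Even ((cocycle hS m).count z) :=
    (((psiMonoid_eq_iff hS _ _).1 hm_psi).2 z).2 (even_count_cocycle_gen_diag_mul_gen hS y z)
  rw [← hm_psi, IsSimple.eq_one_of_even_count hm even_count, map_one]

end PropertyC

namespace FactorMonoid

variable {W : Type*} [Group W] {A : Set W} {w : W} (h : leftFactors A w = Set.univ)

/-- The generator of `M_{w,A}` attached to `v`, when each element of `W` is a factor of `w`. -/
def factorOf (v : W) : FactorMonoid A w :=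
  PresentedMonoid.of (FactorRel A w) ⟨v, h ▸ Set.mem_univ v⟩

lemma factorOf_one : factorOf h 1 = 1 :=
  PresentedMonoid.mk_eq_mk_of_rel (FactorRel.one ⟨1, _⟩ rfl)

lemma factorOf_mul {v v' : W} (hl : length A v + length A v' = length A (v * v')) :
    factorOf h (v * v') = factorOf h v * factorOf h v' :=
  (PresentedMonoid.mk_eq_mk_of_rel (FactorRel.mul ⟨v, _⟩ ⟨v', _⟩ ⟨v * v', _⟩ rfl hl)).symm

/-- The universal property of `M_{w,A}`: a map on `W` that is multiplicative where the length is
additive extends to a morphism. -/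
def lift {N : Type*} [Monoid N] (F : W → N) (F_one : F 1 = 1)
    (F_mul : ∀ v v', length A v + length A v' = length A (v * v') → F (v * v') = F v * F v') :
    FactorMonoid A w →* N :=
  PresentedMonoid.lift (fun v : leftFactors A w => F v) (by
    rintro _ _ (⟨e, he⟩ | ⟨v, v', v'', hv, hl⟩)
    · rw [FreeMonoid.lift_eval_of, map_one, he, F_one]
    · rw [← hv] at hl
      simp only [map_mul, FreeMonoid.lift_eval_of, ← hv, F_mul _ _ hl])

end FactorMonoid

section GeneratedSection

variable {X : Type*} {S : X × X → X × X} {hS : IsNondegenerateSymmetric S} {w : groupW hS}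

lemma IsSimple.factorOf_mul (h : leftFactors (generatorsW hS) w = Set.univ)
    {m n : StructureMonoid S} (hs : IsSimple hS (m * n)) :
    FactorMonoid.factorOf h (psiMonoid hS (m * n)) =
      FactorMonoid.factorOf h (psiMonoid hS m) * FactorMonoid.factorOf h (psiMonoid hS n) := by
  have length_add := hs.length_psiMonoid_mul
  rw [map_mul] at length_add ⊢
  exact FactorMonoid.factorOf_mul h length_add.symm

/-- The morphism from `M(X,S)` to `M_{w,A}` sending `x` to the copy of `ψ_x`. -/
noncomputable def toFactorMonoid (h : leftFactors (generatorsW hS) w = Set.univ) :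
    StructureMonoid S →* FactorMonoid (generatorsW hS) w :=
  PresentedMonoid.lift (fun x => FactorMonoid.factorOf h (psiMonoid hS (gen S x))) (by
    rintro _ _ ⟨x, y, hxy, rfl, rfl⟩
    have simple_xy : IsSimple hS (gen S x * gen S y) := isSimple_gen_mul_gen hS hxy
    simp only [map_mul, FreeMonoid.lift_eval_of]
    rw [← simple_xy.factorOf_mul h, gen_mul_gen,
      IsSimple.factorOf_mul h (gen_mul_gen x y ▸ simple_xy)])

lemma toFactorMonoid_of_isSimple (h : leftFactors (generatorsW hS) w = Set.univ)
    {m : StructureMonoid S} (hm : IsSimple hS m) :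
    toFactorMonoid h m = FactorMonoid.factorOf h (psiMonoid hS m) := by
  induction m using gen_induction with
  | one => rw [map_one, map_one, FactorMonoid.factorOf_one]
  | mul x m ih =>
    rw [map_mul, ih hm.of_mul_right, hm.factorOf_mul h]
    rfl

namespace PropertyC

variable (hC : PropertyC S)

/-- The unique simple element of `M(X,S)` with image `v` in `W(X,S)`. -/
noncomputable def simpleLift (v : groupW hS) : StructureMonoid S :=
  (hC.exists_isSimple_psiMonoid_eq v).choose

lemma isSimple_simpleLift (v : groupW hS) : IsSimple hS (hC.simpleLift v) :=
  (hC.exists_isSimple_psiMonoid_eq v).choose_spec.1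

lemma psiMonoid_simpleLift (v : groupW hS) : psiMonoid hS (hC.simpleLift v) = v :=
  (hC.exists_isSimple_psiMonoid_eq v).choose_spec.2

lemma simpleLift_psiMonoid {m : StructureMonoid S} (hm : IsSimple hS m) :
    hC.simpleLift (psiMonoid hS m) = m :=
  (hC.isSimple_simpleLift _).eq hm (hC.psiMonoid_simpleLift _)

lemma card_cocycle_simpleLift (v : groupW hS) :
    (cocycle hS (hC.simpleLift v)).card = length (generatorsW hS) v := by
  rw [← (hC.isSimple_simpleLift v).length_psiMonoid, hC.psiMonoid_simpleLift]

lemma simpleLift_one : hC.simpleLift (1 : groupW hS) = 1 := by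
  simpa using hC.simpleLift_psiMonoid (isSimple_one hS)

lemma simpleLift_mul {v v' : groupW hS} (hl : length (generatorsW hS) v +
    length (generatorsW hS) v' = length (generatorsW hS) (v * v')) :
    hC.simpleLift (v * v') = hC.simpleLift v * hC.simpleLift v' := by
  refine (hC.isSimple_simpleLift _).eq_of_card_le ?_ ?_
  · simp only [map_mul, psiMonoid_simpleLift]
  · rw [card_cocycle_mul]
    simp only [card_cocycle_simpleLift, hl, le_refl]

/-- The isomorphism between `M(X,S)` and `M_{w,A}` under property `(C)`. -/
noncomputable def factorMonoidEquiv (h : leftFactors (generatorsW hS) w = Set.univ) :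
    StructureMonoid S ≃* FactorMonoid (generatorsW hS) w :=
  MonoidHom.toMulEquiv (toFactorMonoid h)
    (FactorMonoid.lift hC.simpleLift hC.simpleLift_one fun _ _ => hC.simpleLift_mul)
    (by
      ext x
      exact hC.simpleLift_psiMonoid (isSimple_gen hS x))
    (by
      ext v
      refine (toFactorMonoid_of_isSimple h (hC.isSimple_simpleLift v.1)).trans ?_
      rw [psiMonoid_simpleLift]
      rfl)

include hC in
lemma isGeneratingGeneratedSection [Fintype X] :
    IsGeneratingGeneratedSection (generatorsW hS) (psiMonoid hS (garsideElement hS))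
      (StructureMonoid S) := by
  have simple := isSimple_garsideElement hS
  have image_eq_univ := (image_isSimple_eq_univ_iff hS).2 hC
  have left_eq_univ : leftFactors (generatorsW hS) (psiMonoid hS (garsideElement hS)) =
      Set.univ := by
    rw [simple.leftFactors_psiMonoid hC.closure_generatorsW, leftDivisors_garsideElement,
      image_eq_univ]
  have right_eq_univ : rightFactors (generatorsW hS) (psiMonoid hS (garsideElement hS)) =
      Set.univ := by
    rw [simple.rightFactors_psiMonoid hC.closure_generatorsW, rightDivisors_garsideElement,
      image_eq_univ]
  exact {
    finite := Set.finite_univ_iff.1 (image_eq_univ ▸ (finite_setOf_isSimple hS).image _)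
    generates := hC.closure_generatorsW
    balanced := left_eq_univ.trans right_eq_univ.symm
    factors_generate := by rw [left_eq_univ, Subgroup.closure_univ]
    iso := ⟨hC.factorMonoidEquiv left_eq_univ⟩
    factors_eq_univ := left_eq_univ }

end PropertyC

variable (hS) in
lemma image_leftDivisors_garsideElement_eq_univ_iff [Fintype X] :
    psiMonoid hS '' leftDivisors (garsideElement hS) = Set.univ ↔ PropertyC S := by
  rw [leftDivisors_garsideElement, image_isSimple_eq_univ_iff]

variable (hS) in
lemma isGeneratingGeneratedSection_garsideElement_iff [Fintype X] :
    IsGeneratingGeneratedSection (generatorsW hS) (psiMonoid hS (garsideElement hS))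
      (StructureMonoid S) ↔ PropertyC S := by
  refine ⟨fun h => ?_, fun hC => hC.isGeneratingGeneratedSection⟩
  rw [← image_leftDivisors_garsideElement_eq_univ_iff hS,
    ← (isSimple_garsideElement hS).leftFactors_psiMonoid h.generates, h.factors_eq_univ]

end GeneratedSection

end YangBaxter

open YangBaxter in
theorem mainTheorem2 {X : Type*} [Finite X] (S : X × X → X × X)
    (hS : YangBaxter.IsNondegenerateSymmetric S) :
    (∃! Δ : YangBaxter.StructureMonoid S, YangBaxter.IsLeastGarsideElement Δ) ∧
    ∀ Δ : YangBaxter.StructureMonoid S, YangBaxter.IsLeastGarsideElement Δ →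
      (YangBaxter.IsGeneratingGeneratedSection (YangBaxter.generatorsW hS)
          (YangBaxter.psiMonoid hS Δ) (YangBaxter.StructureMonoid S) ↔
        YangBaxter.PropertyC S) ∧
      (YangBaxter.psiMonoid hS '' YangBaxter.leftDivisors Δ = Set.univ ↔
        YangBaxter.PropertyC S) ∧
      (YangBaxter.PropertyC S → ∀ x y : X, YangBaxter.IsFrozenPair S x y →
        YangBaxter.toStructureGroup S
            (PresentedMonoid.of (YangBaxter.monoidRels S) x *
              PresentedMonoid.of (YangBaxter.monoidRels S) y) ∈ (YangBaxter.psi hS).ker) := by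
  cases nonempty_fintype X
  refine ⟨⟨garsideElement hS, isLeastGarsideElement_garsideElement hS,
    fun Δ hΔ => hΔ.eq_garsideElement⟩, fun Δ hΔ => ?_⟩
  obtain rfl := hΔ.eq_garsideElement (hS := hS)
  refine ⟨isGeneratingGeneratedSection_garsideElement_iff hS,
    image_leftDivisors_garsideElement_eq_univ_iff hS, fun hC x y hxy => ?_⟩
  exact congrArg Subtype.val ((propertyC_iff_psiMonoid_frozen hS).1 hC x y hxy)
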